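/- Let $k$ be an algebraically closed field, let $V$ be a $k$-vector space of finite positive dimension, let $G=\mathrm{GL}(V)$, and let $e\ge 0$ be an integer. A subgroup $H\le G$ acts primitively on $V$ if it acts irreducibly and preserves no additive decomposition of $V$; that is, there is no decomposition $V=W_1\oplus\cdots\oplus W_m$ with $m\ge 2$ and all $W_i\neq 0$ such that every element of $H$ permutes the subspaces $W_1,\dots,W_m$. Then the set of tuples $(x_1,\dots,x_e)\in G^e$ such that the generated group $\langle x_1,\dots,x_e\rangle$ acts primitively on $V$ is Zariski open in $G^e$. Likewise, the set of tuples $(x_1,\dots,x_e)\in G^e$ such that the Zariski closure of $\langle x_1,\dots,x_e\rangle$ in $G$ acts primitively on $V$ is Zariski open in $G^e$. -/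

import Mathlib

open Topology

namespace PrimitiveTuples

/-- The Zariski topology on a set `X` of points with a given algebra `A` of regular functions
`X → k`: a set is closed if and only if it is the common zero set of a set of functions in `A`. -/
@[reducible] def zariskiTopology {k : Type*} [Field k] {X : Type*} (A : Subalgebra k (X → k)) :
    TopologicalSpace X :=
  TopologicalSpace.ofClosed
    {Z | ∃ S : Set (X → k), S ⊆ A ∧ Z = {x | ∀ f ∈ S, f x = 0}}
    ⟨{1}, by simp, by ext x; simp⟩
    (by
      intro C hC
      refine ⟨{f | f ∈ A ∧ ∃ Z ∈ C, ∀ x ∈ Z, f x = 0}, fun f hf => hf.1, ?_⟩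
      ext x
      constructor
      · rintro hx f ⟨-, Z, hZ, hf⟩
        exact hf x (hx Z hZ)
      · intro hx Z hZ
        obtain ⟨S, hS, rfl⟩ := hC hZ
        exact fun f hf => hx f ⟨hS hf, _, hZ, fun y hy => hy f hf⟩)
    (by
      rintro _ ⟨S, hS, rfl⟩ _ ⟨T, hT, rfl⟩
      refine ⟨{h | ∃ f ∈ S, ∃ g ∈ T, h = f * g}, ?_, ?_⟩
      · rintro _ ⟨f, hf, g, hg, rfl⟩
        exact A.mul_mem (hS hf) (hT hg)
      · ext x
        constructor
        · rintro (hx | hx) _ ⟨f, hf, g, hg, rfl⟩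
          · simp [hx f hf]
          · simp [hx g hg]
        · intro hx
          by_contra hcon
          simp only [Set.mem_union, Set.mem_ofPred_eq, not_or, not_forall] at hcon
          obtain ⟨⟨f, hf, hfx⟩, ⟨g, hg, hgx⟩⟩ := hcon
          have := hx _ ⟨f, hf, g, hg, rfl⟩
          simp only [Pi.mul_apply, mul_eq_zero] at this
          exact this.elim hfx hgx)

theorem isClosed_zariskiTopology_iff {k : Type*} [Field k] {X : Type*} (A : Subalgebra k (X → k))
    (Z : Set X) :
    IsClosed[zariskiTopology A] Z ↔
      ∃ S : Set (X → k), S ⊆ A ∧ Z = {x | ∀ f ∈ S, f x = 0} := by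
  rw [← @isOpen_compl_iff X Z (zariskiTopology A)]
  change Zᶜᶜ ∈ _ ↔ _
  rw [compl_compl]
  rfl

section GenLin

variable (k : Type*) [Field k] (V : Type*) [AddCommGroup V] [Module k V]

/-- The coordinate ring of the algebraic group `GL(V)`, as an algebra of functions on `GL(V)`:
it is generated by the matrix coefficients `g ↦ φ (g v)` and `g ↦ φ (g⁻¹ v)`. (In coordinates
this is `k[x₁₁, …, xₙₙ, 1/det]`.) -/
def coordRingGL : Subalgebra k (LinearMap.GeneralLinearGroup k V → k) :=
  Algebra.adjoin k
    ({f | ∃ (φ : Module.Dual k V) (v : V), f = fun g => φ (g.val v)} ∪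
      {f | ∃ (φ : Module.Dual k V) (v : V), f = fun g => φ ((g⁻¹).val v)})

/-- The coordinate ring of the product variety `GL(V)^e`: it is generated by the pullbacks
of the regular functions on `GL(V)` along the `e` coordinate projections. -/
def coordRingGLPow (e : ℕ) :
    Subalgebra k ((Fin e → LinearMap.GeneralLinearGroup k V) → k) :=
  Algebra.adjoin k {F | ∃ (i : Fin e), ∃ f ∈ coordRingGL k V, F = fun x => f (x i)}

/-- The Zariski topology on `GL(V)`. -/
@[reducible] def zariskiGL : TopologicalSpace (LinearMap.GeneralLinearGroup k V) :=
  zariskiTopology (coordRingGL k V)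

/-- The Zariski topology on `GL(V)^e`. -/
@[reducible] def zariskiGLPow (e : ℕ) : TopologicalSpace (Fin e → LinearMap.GeneralLinearGroup k V) :=
  zariskiTopology (coordRingGLPow k V e)

variable {k V}

theorem continuous_zariskiGL (F : LinearMap.GeneralLinearGroup k V → LinearMap.GeneralLinearGroup k V)
    (h₁ : ∀ (φ : Module.Dual k V) (v : V), (fun g => φ ((F g).val v)) ∈ coordRingGL k V)
    (h₂ : ∀ (φ : Module.Dual k V) (v : V), (fun g => φ (((F g)⁻¹).val v)) ∈ coordRingGL k V) :
    @Continuous _ _ (zariskiGL k V) (zariskiGL k V) F := by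
  have key : ∀ f ∈ coordRingGL k V, (fun g => f (F g)) ∈ coordRingGL k V := by
    intro f hf
    induction hf using Algebra.adjoin_induction with
    | mem f hf =>
      rcases hf with ⟨φ, v, rfl⟩ | ⟨φ, v, rfl⟩
      · exact h₁ φ v
      · exact h₂ φ v
    | algebraMap r => exact (coordRingGL k V).algebraMap_mem r
    | add f g _ _ hf hg => exact (coordRingGL k V).add_mem hf hg
    | mul f g _ _ hf hg => exact (coordRingGL k V).mul_mem hf hg
  let _ := zariskiGL k V
  rw [continuous_iff_isClosed]
  intro Z hZ
  obtain ⟨S, hS, rfl⟩ := (isClosed_zariskiTopology_iff _ Z).1 hZ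
  refine (isClosed_zariskiTopology_iff _ _).2 ⟨(fun f g => f (F g)) '' S, ?_, ?_⟩
  · rintro _ ⟨f, hf, rfl⟩
    exact key f (hS hf)
  · ext x
    simp

theorem coeff_mem_coordRingGL (φ : Module.Dual k V) (v : V) :
    (fun g : LinearMap.GeneralLinearGroup k V => φ (g.val v)) ∈ coordRingGL k V :=
  Algebra.subset_adjoin (Or.inl ⟨φ, v, rfl⟩)

theorem coeff_inv_mem_coordRingGL (φ : Module.Dual k V) (v : V) :
    (fun g : LinearMap.GeneralLinearGroup k V => φ ((g⁻¹).val v)) ∈ coordRingGL k V :=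
  Algebra.subset_adjoin (Or.inr ⟨φ, v, rfl⟩)

theorem continuous_inv_zariskiGL :
    @Continuous _ _ (zariskiGL k V) (zariskiGL k V) (fun g => g⁻¹) :=
  continuous_zariskiGL _ (fun φ v => coeff_inv_mem_coordRingGL φ v)
    (fun φ v => by simpa using coeff_mem_coordRingGL φ v)

theorem continuous_mul_left_zariskiGL (h : LinearMap.GeneralLinearGroup k V) :
    @Continuous _ _ (zariskiGL k V) (zariskiGL k V) (fun g => h * g) :=
  continuous_zariskiGL _ (fun φ v => coeff_mem_coordRingGL (φ ∘ₗ h.val) v)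
    (fun φ v => by simpa using coeff_inv_mem_coordRingGL φ ((h⁻¹).val v))

theorem continuous_mul_right_zariskiGL (h : LinearMap.GeneralLinearGroup k V) :
    @Continuous _ _ (zariskiGL k V) (zariskiGL k V) (fun g => g * h) :=
  continuous_zariskiGL _ (fun φ v => coeff_mem_coordRingGL φ (h.val v))
    (fun φ v => by simpa using coeff_inv_mem_coordRingGL (φ ∘ₗ (h⁻¹).val) v)

/-- The Zariski closure in `GL(V)` of a subgroup of `GL(V)`; it is again a subgroup. -/
def zariskiClosure (H : Subgroup (LinearMap.GeneralLinearGroup k V)) :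
    Subgroup (LinearMap.GeneralLinearGroup k V) where
  carrier := @closure _ (zariskiGL k V) (H : Set (LinearMap.GeneralLinearGroup k V))
  one_mem' := @subset_closure _ (zariskiGL k V) _ _ H.one_mem
  inv_mem' := by
    let _ := zariskiGL k V
    intro x hx
    exact map_mem_closure continuous_inv_zariskiGL hx fun y hy => H.inv_mem hy
  mul_mem' := by
    let _ := zariskiGL k V
    intro x y hx hy
    have h₁ : ∀ a ∈ H, a * y ∈ closure (H : Set (LinearMap.GeneralLinearGroup k V)) :=
      fun a ha => map_mem_closure (continuous_mul_left_zariskiGL a) hy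
        fun b hb => H.mul_mem ha hb
    have h₂ := map_mem_closure (continuous_mul_right_zariskiGL y) hx h₁
    rwa [closure_closure] at h₂

/-- The natural representation on `V` of a subgroup of `GL(V)`. -/
def naturalRep (H : Subgroup (LinearMap.GeneralLinearGroup k V)) : Representation k H V :=
  (Units.coeHom (V →ₗ[k] V)).comp H.subtype

/-- `H` preserves an additive decomposition of `V`: there are `m ≥ 2` nonzero subspaces
`W₁, …, Wₘ` with `V = W₁ ⊕ ⋯ ⊕ Wₘ` such that every element of `H` permutes the `Wᵢ`. -/
def PreservesDecomposition (H : Subgroup (LinearMap.GeneralLinearGroup k V)) : Prop :=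
  ∃ (m : ℕ) (W : Fin m → Submodule k V), 2 ≤ m ∧ (∀ i, W i ≠ ⊥) ∧ DirectSum.IsInternal W ∧
    ∀ g ∈ H, ∃ σ : Equiv.Perm (Fin m), ∀ i, (W i).map g.val = W (σ i)

/-- `H` acts primitively on `V`: it acts irreducibly and preserves no additive decomposition
of `V`. -/
def ActsPrimitively (H : Subgroup (LinearMap.GeneralLinearGroup k V)) : Prop :=
  (naturalRep H).IsIrreducible ∧ ¬ PreservesDecomposition H

end GenLin

end PrimitiveTuples

open Topology

namespace PrimitiveTuples

/-! Let F be the free group on e letters. A tuple ω is a representation of F on V, and each word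
acts with matrix coefficients regular in ω. Irreducibility says that the F-orbit of every nonzero v
spans V. For irreducible ω, imprimitivity amounts to an action of F on m points, 2 ≤ m ≤ dim V, with
a point j and a nonzero v whose orbit under the stabilizer of j spans dimension at most dim V / m;
translates of that span are the blocks (`preservesDecomposition_range_lift_iff`).

The stabilizer is a subgroup of F independent of ω, and there are finitely many such actions. So
primitivity is a finite conjunction of conditions "every nonzero v has span of dimension > d". Each
fails on the projection of a closed subset of G^e × P(V) cut out by minors, which is closed because
P(V) is complete (`exists_forall_eq_zero_of_isHomogeneous`, `isOpen_forall_lt_finrank_span`).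

A subgroup and its Zariski closure preserve the same subspaces and decompositions, so the second
claim reduces to the first. -/

/-! ### Elimination theory -/

open MvPolynomial in
theorem sum_coeff_mul_eq_zero {R K σ : Type*} [CommRing R] [CommRing K] [Finite σ]
    {P : MvPolynomial σ R} {D : ℕ} (hP : P.IsHomogeneous D) (ψ : R →+* K) (v : σ → K)
    (h : eval₂ ψ v P = 0) (M : ℕ) [Fintype {m : σ →₀ ℕ // m.degree = M}] :
    ∑ m : {m : σ →₀ ℕ // m.degree = M}, ψ (coeff m.1 P) * (m.1.prod fun i n => v i ^ n) = 0 := by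
  by_cases hD : D = M
  · subst hD
    rw [← h, eval₂_eq, ← Finset.sum_subtype_of_mem (p := fun m : σ →₀ ℕ => m.degree = D)
      (fun m => ψ (coeff m P) * (∏ i ∈ m.support, v i ^ m i))
      (fun m hm => by
        by_contra hne
        exact (mem_support_iff.1 hm) (hP.coeff_eq_zero hne))]
    symm
    apply Finset.sum_subset (Finset.subset_univ _)
    intro m _ hm
    simp only [Finset.mem_subtype, mem_support_iff, not_not] at hm
    simp [hm]
  · refine Finset.sum_eq_zero fun m _ => ?_
    rw [hP.coeff_eq_zero (fun h' => hD (h'.symm.trans m.2)), map_zero, zero_mul]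

theorem exists_det_ne_zero_of_span_eq_top {R K ι W : Type*} [CommRing R] [Field K] [Fintype W]
    [DecidableEq W] (ψ : R →+* K) (f : ι → W → R)
    (h : Submodule.span K (Set.range fun i => ψ ∘ f i) = ⊤) :
    ∃ a : W → ι, ψ (Matrix.det (Matrix.of fun w => f (a w))) ≠ 0 := by
  obtain ⟨κ, a, -, hsp, hli⟩ := exists_linearIndependent' K fun i => ψ ∘ f i
  rw [h] at hsp
  let b := Module.Basis.mk hli hsp.ge
  let e : W ≃ κ := (Pi.basisFun K W).indexEquiv b
  refine ⟨a ∘ e, ?_⟩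
  have hli' := hli.comp e e.injective
  rw [RingHom.map_det]
  have : LinearIndependent K (Matrix.row (ψ.mapMatrix (Matrix.of fun w => f ((a ∘ e) w)))) := hli'
  rw [Matrix.linearIndependent_rows_iff_isUnit, Matrix.isUnit_iff_isUnit_det] at this
  exact this.ne_zero

open MvPolynomial in
/-- Openness form of the main theorem of elimination theory: if a family of homogeneous forms has
only the trivial common zero after one specialization of the coefficients, then this remains true
for all specializations at which a suitable element does not vanish. -/
theorem exists_forall_eq_zero_of_isHomogeneous {R K σ ι : Type*} [CommRing R] [Field K]
    [IsAlgClosed K] [Finite σ] (F : ι → MvPolynomial σ R) (D : ι → ℕ)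
    (hF : ∀ j, (F j).IsHomogeneous (D j)) (ψ₀ : R →+* K)
    (h₀ : ∀ v : σ → K, (∀ j, eval₂ ψ₀ v (F j) = 0) → v = 0) :
    ∃ r : R, ψ₀ r ≠ 0 ∧ ∀ ψ : R →+* K, ψ r ≠ 0 →
      ∀ v : σ → K, (∀ j, eval₂ ψ v (F j) = 0) → v = 0 := by
  classical
  have := Fintype.ofFinite σ
  let I : Ideal (MvPolynomial σ K) := Ideal.span (Set.range fun j => map ψ₀ (F j))
  -- Nullstellensatz: the specialized forms vanish together only at the origin, so some power M of
  -- the ideal of variables lies in `I`.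
  have hrad : idealOfVars σ K ≤ I.radical := by
    rw [← vanishingIdeal_zeroLocus_eq_radical (K := K), idealOfVars, Ideal.span_le]
    rintro _ ⟨i, rfl⟩ v hv
    rw [zeroLocus_span] at hv
    have := h₀ v fun j => by simpa [aeval_def, eval₂_map] using hv _ ⟨j, rfl⟩
    simp [this]
  obtain ⟨M, hM⟩ := Ideal.exists_pow_le_of_le_radical_of_fg hrad (IsNoetherian.noetherian _)
  have : Fintype {m : σ →₀ ℕ // m.degree = M} :=
    ((Finsupp.finite_of_degree_le (σ := σ) M).subset fun m (hm : m.degree = M) => hm.le).fintype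
  let W := {m : σ →₀ ℕ // m.degree = M}
  let f : (σ →₀ ℕ) × ι → W → R := fun p w => coeff w.1 (monomial p.1 1 * F p.2)
  let T : MvPolynomial σ K →ₗ[K] (W → K) := LinearMap.pi fun w => lcoeff K w.1
  have key : ∀ (q : MvPolynomial σ K) (j : ι),
      T (q * map ψ₀ (F j)) ∈ Submodule.span K (Set.range fun i => ψ₀ ∘ f i) := by
    intro q j
    induction q using MvPolynomial.induction_on' with
    | monomial u a =>
      have : T (monomial u a * map ψ₀ (F j)) = a • (ψ₀ ∘ f (u, j)) := by
        have h1 : monomial u a * map ψ₀ (F j) = a • map ψ₀ (monomial u 1 * F j) := by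
          rw [map_mul, map_monomial, map_one, ← smul_mul_assoc, smul_monomial, smul_eq_mul,
            mul_one]
        rw [h1, map_smul]
        rfl
      rw [this]
      exact Submodule.smul_mem _ _ (Submodule.subset_span ⟨_, rfl⟩)
    | add p q hp hq =>
      rw [add_mul, map_add]
      exact Submodule.add_mem _ hp hq
  have hT : ∀ p ∈ I, ∀ q, T (q * p) ∈ Submodule.span K (Set.range fun i => ψ₀ ∘ f i) := by
    intro p hp
    induction hp using Submodule.span_induction with
    | mem x hx => obtain ⟨j, rfl⟩ := hx; exact fun q => key q j
    | zero => simp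
    | add x y _ _ hx hy =>
      intro q
      rw [mul_add, map_add]
      exact Submodule.add_mem _ (hx q) (hy q)
    | smul a x _ hx =>
      intro q
      rw [smul_eq_mul, ← mul_assoc]
      exact hx _
  -- Every degree-M monomial lies in `I`, so the degree-M parts of monomial multiples of the forms
  -- span all forms of degree M. The element `r` is a maximal minor witnessing this.
  have hspan : Submodule.span K (Set.range fun i => ψ₀ ∘ f i) = ⊤ := by
    rw [eq_top_iff, ← (Pi.basisFun K W).span_eq, Submodule.span_le]
    rintro _ ⟨w, rfl⟩
    have hw : monomial w.1 (1 : K) ∈ I := by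
      refine hM ((mem_pow_idealOfVars_iff' ..).2 fun x hx => ?_)
      rw [coeff_monomial, if_neg]
      rintro rfl
      exact absurd w.2 hx.ne
    have := hT _ hw 1
    convert! this using 1
    ext w'
    simp only [Pi.basisFun_apply, Pi.single_apply, one_mul, LinearMap.pi_apply, lcoeff_apply,
      coeff_monomial, T]
    exact if_congr (by rw [Subtype.ext_iff, eq_comm]) rfl rfl
  obtain ⟨a, ha⟩ := exists_det_ne_zero_of_span_eq_top ψ₀ f hspan
  refine ⟨_, ha, fun ψ hψ v hv => ?_⟩
  rw [RingHom.map_det] at hψ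
  -- At a common zero v, the matrix kills the vector of degree-M monomials in v; being invertible,
  -- it forces v i ^ M = 0 for each i.
  have hz := Matrix.eq_zero_of_mulVec_eq_zero (v := fun w : W => w.1.prod fun i n => v i ^ n) hψ
    (by
      ext w
      refine sum_coeff_mul_eq_zero ((isHomogeneous_monomial 1 rfl).mul (hF (a w).2)) ψ v ?_ M
      rw [eval₂_mul, hv, mul_zero])
  ext i
  have := congrFun hz ⟨Finsupp.single i M, by simp⟩
  simp only [pow_zero, Finsupp.prod_single_index, Pi.zero_apply] at this
  exact eq_zero_of_pow_eq_zero this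

/-! ### Open rank conditions -/

theorem isOpen_zariskiTopology_iff {k : Type*} [Field k] {X : Type*} (A : Subalgebra k (X → k))
    (U : Set X) :
    IsOpen[zariskiTopology A] U ↔ ∀ x ∈ U, ∃ f ∈ A, f x ≠ 0 ∧ ∀ y, f y ≠ 0 → y ∈ U := by
  rw [← @isClosed_compl_iff X (zariskiTopology A), isClosed_zariskiTopology_iff]
  constructor
  · rintro ⟨S, hS, h⟩ x hx
    rw [compl_eq_comm] at h
    subst h
    simp only [Set.mem_compl_iff, Set.mem_ofPred_eq, not_forall] at hx
    obtain ⟨f, hf, hfx⟩ := hx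
    exact ⟨f, hS hf, hfx, fun y hy hy' => hy (hy' f hf)⟩
  · intro h
    refine ⟨{f | f ∈ A ∧ ∀ y ∉ U, f y = 0}, fun f hf => hf.1, ?_⟩
    ext x
    refine ⟨fun hx f hf => hf.2 x hx, fun hx hxU => ?_⟩
    obtain ⟨f, hf, hfx, hy⟩ := h x hxU
    exact hfx (hx f ⟨hf, fun y hyU => by_contra fun hne => hyU (hy y hne)⟩)

theorem isHomogeneous_det {R σ n : Type*} [CommRing R] [Fintype n] [DecidableEq n]
    (M : Matrix n n (MvPolynomial σ R)) (h : ∀ i j, (M i j).IsHomogeneous 1) :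
    M.det.IsHomogeneous (Fintype.card n) := by
  rw [Matrix.det_apply]
  refine MvPolynomial.IsHomogeneous.sum _ _ _ fun s _ => ?_
  have := MvPolynomial.IsHomogeneous.prod Finset.univ (fun i => M (s i) i) (fun _ => 1)
    fun i _ => h _ _
  rw [Finset.sum_const, smul_eq_mul, mul_one, Finset.card_univ] at this
  rcases Int.units_eq_one_or (Equiv.Perm.sign s) with h | h
  · simpa [h] using this
  · simpa [h] using this.neg

theorem eval₂_det {R K σ n : Type*} [CommRing R] [CommRing K] [Fintype n] [DecidableEq n]
    (ψ : R →+* K) (c : σ → K) (M : Matrix n n (MvPolynomial σ R)) :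
    M.det.eval₂ ψ c = (M.map fun p => p.eval₂ ψ c).det := by
  rw [← MvPolynomial.coe_eval₂Hom, RingHom.map_det]
  rfl

theorem finrank_span_le_iff_det_eq_zero {k V : Type*} [Field k] [AddCommGroup V] [Module k V]
    [FiniteDimensional k V] (s : Set V) (d : ℕ) :
    Module.finrank k (Submodule.span k s) ≤ d ↔
      ∀ (u : Fin (d + 1) → s) (φ : Fin (d + 1) → Module.Dual k V),
        Matrix.det (Matrix.of fun a b => φ a (u b)) = 0 := by
  constructor
  · intro h u φ
    by_contra hne
    have hli : LinearIndependent k fun b => (u b : V) := by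
      rw [Fintype.linearIndependent_iff]
      intro g hg
      refine congrFun (Matrix.eq_zero_of_mulVec_eq_zero hne ?_)
      ext a
      have := congrArg (φ a) hg
      simpa [Matrix.mulVec, dotProduct, mul_comm] using this
    have hli' : LinearIndependent k
        fun b => (⟨u b, Submodule.subset_span (u b).2⟩ : Submodule.span k s) :=
      LinearIndependent.of_comp (Submodule.span k s).subtype hli
    have := hli'.fintype_card_le_finrank
    rw [Fintype.card_fin] at this
    omega
  · intro h
    by_contra! hd
    obtain ⟨f, hf, -, hli⟩ := Submodule.exists_fun_fin_finrank_span_eq k s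
    let c : Fin (d + 1) → Fin (Module.finrank k (Submodule.span k s)) := Fin.castLE hd
    have hli' : LinearIndependent k (f ∘ c) := hli.comp c (Fin.castLE_injective hd)
    -- The coordinates of a left inverse are functionals dual to the independent vectors, so this
    -- minor is 1.
    obtain ⟨g, hg⟩ := (Fintype.linearCombination k (f ∘ c)).exists_leftInverse_of_injective
      (LinearMap.ker_eq_bot.2 (linearIndependent_iff_injective_fintypeLinearCombination.1 hli'))
    have := h (fun b => ⟨f (c b), hf _⟩) fun a => LinearMap.proj a ∘ₗ g
    rw [show (Matrix.of fun a b => (LinearMap.proj a ∘ₗ g) (f (c b)) : Matrix _ _ k) = 1 from ?_,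
      Matrix.det_one] at this
    · exact one_ne_zero this
    · ext a b
      have h1 := LinearMap.congr_fun hg (Pi.single b 1)
      simp only [LinearMap.comp_apply, Fintype.linearCombination_apply_single, one_smul,
        Function.comp_apply, LinearMap.id_apply] at h1
      simp [h1, Matrix.one_apply, Pi.single_apply]

/-- For a family of linear endomorphisms with regular coefficients, the locus where every nonzero
vector has orbit span of dimension greater than `d` is open. -/
theorem isOpen_forall_lt_finrank_span {k : Type*} [Field k] [IsAlgClosed k] {V : Type*}
    [AddCommGroup V] [Module k V] [FiniteDimensional k V] {X : Type*} (A : Subalgebra k (X → k))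
    {S : Type*} (s : S → X → Module.End k V)
    (hs : ∀ i (φ : Module.Dual k V) (v : V), (fun x => φ (s i x v)) ∈ A) (d : ℕ) :
    IsOpen[zariskiTopology A]
      {x | ∀ v : V, v ≠ 0 →
        d < Module.finrank k (Submodule.span k (Set.range fun i => s i x v))} := by
  rw [isOpen_zariskiTopology_iff]
  intro x₀ hx₀
  let e := Module.finBasis k V
  -- φ (s i x v) as a linear form in the coordinates of v with coefficients in `A`; the minors `F`
  -- are then homogeneous of degree d + 1.
  let L (φ : Module.Dual k V) (i : S) : MvPolynomial (Fin (Module.finrank k V)) A :=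
    ∑ t, MvPolynomial.C (⟨_, hs i φ (e t)⟩ : A) * MvPolynomial.X t
  let F (p : (Fin (d + 1) → S) × (Fin (d + 1) → Module.Dual k V)) :
      MvPolynomial (Fin (Module.finrank k V)) A :=
    Matrix.det (Matrix.of fun a b => L (p.2 a) (p.1 b))
  let ev (x : X) : A →+* k := (Pi.evalRingHom (fun _ => k) x).comp A.subtype
  have hL : ∀ φ i x c, (L φ i).eval₂ (ev x) c = φ (s i x (∑ t, c t • e t)) := by
    intro φ i x c
    simp [L, ev, MvPolynomial.eval₂_sum, mul_comm]
  have hLhom : ∀ φ i, (L φ i).IsHomogeneous 1 := fun φ i =>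
    MvPolynomial.IsHomogeneous.sum _ _ _ fun t _ => MvPolynomial.isHomogeneous_C_mul_X _ _
  have hFev : ∀ p x c, (F p).eval₂ (ev x) c =
      Matrix.det (Matrix.of fun a b => p.2 a (s (p.1 b) x (∑ t, c t • e t))) := by
    intro p x c
    refine (eval₂_det _ _ _).trans ?_
    congr 1
    ext a b
    exact hL _ _ _ _
  have hiff : ∀ x c, (∀ p, (F p).eval₂ (ev x) c = 0) ↔
      Module.finrank k (Submodule.span k (Set.range fun i => s i x (∑ t, c t • e t))) ≤ d := by
    intro x c
    rw [finrank_span_le_iff_det_eq_zero]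
    constructor
    · intro h u φ
      choose j hj using fun b => (u b).2
      rw [← h (j, φ), hFev]
      simp only [← hj]
    · intro h p
      rw [hFev]
      exact h (fun b => ⟨_, p.1 b, rfl⟩) p.2
  have hc : ∀ x, x ∈ {x | ∀ v : V, v ≠ 0 →
      d < Module.finrank k (Submodule.span k (Set.range fun i => s i x v))} ↔
      ∀ c, (∀ p, (F p).eval₂ (ev x) c = 0) → c = 0 := by
    intro x
    simp only [hiff, Set.mem_ofPred_eq]
    constructor
    · intro h c hcd
      by_contra hne
      refine absurd (h (∑ t, c t • e t) fun h0 => hne ?_) hcd.not_gt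
      exact funext (Fintype.linearIndependent_iff.1 e.linearIndependent c h0)
    · intro h v hv
      by_contra! hle
      refine hv (e.repr.map_eq_zero_iff.1 (DFunLike.coe_injective (h (e.repr v) ?_)))
      rwa [e.sum_repr]
  obtain ⟨r, hr, hy⟩ := exists_forall_eq_zero_of_isHomogeneous F (fun _ => Fintype.card (Fin (d + 1)))
    (fun p => isHomogeneous_det _ fun a b => hLhom _ _) (ev x₀) ((hc x₀).1 hx₀)
  exact ⟨r, r.2, hr, fun y hy' => (hc y).2 (hy (ev y) hy')⟩

/-! ### Irreducibility and decompositions through the free group -/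

section

variable {k : Type*} [Field k] {V : Type*} [AddCommGroup V] [Module k V]

theorem isIrreducible_naturalRep_iff [Nontrivial V]
    (H : Subgroup (LinearMap.GeneralLinearGroup k V)) :
    (naturalRep H).IsIrreducible ↔
      ∀ U : Submodule k V, (∀ g ∈ H, ∀ u ∈ U, g.val u ∈ U) → U = ⊥ ∨ U = ⊤ := by
  constructor
  · intro h U hU
    exact (h.eq_bot_or_eq_top ⟨U, fun g v hv => hU g.1 g.2 v hv⟩).imp
      (congrArg Subrepresentation.toSubmodule) (congrArg Subrepresentation.toSubmodule)
  · intro h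
    have : Nontrivial (Subrepresentation (naturalRep H)) :=
      ⟨⊥, ⊤, fun hbt => bot_ne_top (α := Submodule k V)
        (congrArg Subrepresentation.toSubmodule hbt)⟩
    refine ⟨fun U => ?_⟩
    exact (h U.toSubmodule fun g hg u hu => U.apply_mem_toSubmodule ⟨g, hg⟩ hu).imp
      (fun h => Subrepresentation.toSubmodule_injective h)
      (fun h => Subrepresentation.toSubmodule_injective h)

theorem isIrreducible_naturalRep_range_iff [Nontrivial V] {F : Type*} [Group F]
    (ρ : F →* LinearMap.GeneralLinearGroup k V) :
    (naturalRep ρ.range).IsIrreducible ↔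
      ∀ v : V, v ≠ 0 → Submodule.span k (Set.range fun w => (ρ w).val v) = ⊤ := by
  rw [isIrreducible_naturalRep_iff]
  constructor
  · intro h v hv
    refine (h _ ?_).resolve_left fun hbot => hv ?_
    · rintro _ ⟨g, rfl⟩ u hu
      induction hu using Submodule.span_induction with
      | mem x hx =>
        obtain ⟨w, rfl⟩ := hx
        refine Submodule.subset_span ⟨g * w, ?_⟩
        simp
      | zero => simp
      | add x y _ _ hx hy => rw [map_add]; exact Submodule.add_mem _ hx hy
      | smul a x _ hx => rw [map_smul]; exact Submodule.smul_mem _ _ hx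
    · rw [Submodule.span_eq_bot] at hbot
      exact hbot v ⟨1, by simp⟩
  · intro h U hU
    refine or_iff_not_imp_left.2 fun hne => ?_
    obtain ⟨v, hv, hv0⟩ := U.exists_mem_ne_zero_of_ne_bot hne
    rw [eq_top_iff, ← h v hv0, Submodule.span_le]
    rintro _ ⟨w, rfl⟩
    exact hU _ ⟨w, rfl⟩ v hv

/-- A finite family of at most `d`-dimensional subspaces spanning a space of dimension at least
`m * d` is an internal direct sum of `d`-dimensional subspaces. -/
theorem isInternal_of_iSup_eq_top_of_finrank_le [FiniteDimensional k V] {m d : ℕ}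
    (W : Fin m → Submodule k V) (htop : ⨆ i, W i = ⊤) (hd : ∀ i, Module.finrank k (W i) ≤ d)
    (hn : m * d ≤ Module.finrank k V) :
    DirectSum.IsInternal W ∧ ∀ i, Module.finrank k (W i) = d := by
  classical
  have hsurj : Function.Surjective (DirectSum.coeLinearMap W) := by
    rw [← LinearMap.range_eq_top, DirectSum.range_coeLinearMap, htop]
  have hsum : Module.finrank k (DirectSum (Fin m) fun i => W i) =
      ∑ i, Module.finrank k (W i) := Module.finrank_directSum k _
  have hle : ∑ i, Module.finrank k (W i) ≤ m * d := by
    simpa using Finset.sum_le_sum fun i (_ : i ∈ Finset.univ) => hd i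
  have hge := LinearMap.finrank_le_finrank_of_surjective hsurj
  have heq : Module.finrank k (DirectSum (Fin m) fun i => W i) = Module.finrank k V := by omega
  refine ⟨⟨(LinearMap.injective_iff_surjective_of_finrank_eq_finrank heq).2 hsurj, hsurj⟩, ?_⟩
  have hs : ∑ i, Module.finrank k (W i) = ∑ _i : Fin m, d := by
    rw [Finset.sum_const, Finset.card_univ, Fintype.card_fin, smul_eq_mul]
    omega
  exact fun i => (Finset.sum_eq_sum_iff_of_le fun i _ => hd i).1 hs i (Finset.mem_univ i)

/-- An irreducible image of a free group preserves a decomposition if and only if some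
point stabilizer in a permutation action of the free group on `m ≥ 2` points has a small orbit
span. -/
theorem preservesDecomposition_range_lift_iff [FiniteDimensional k V] {ι : Type*}
    (ω : ι → LinearMap.GeneralLinearGroup k V)
    (hirr : ∀ v : V, v ≠ 0 →
      Submodule.span k (Set.range fun w => (FreeGroup.lift ω w).val v) = ⊤) :
    PreservesDecomposition (FreeGroup.lift ω).range ↔
      ∃ m, 2 ≤ m ∧ m ≤ Module.finrank k V ∧ ∃ (σ : ι → Equiv.Perm (Fin m)) (j : Fin m) (v : V),
        v ≠ 0 ∧ Module.finrank k (Submodule.span k (Set.range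
          fun w : {w : FreeGroup ι // FreeGroup.lift σ w j = j} =>
            (FreeGroup.lift ω w.1).val v)) ≤ Module.finrank k V / m := by
  constructor
  · rintro ⟨m, W, hm, hne, hint, hperm⟩
    choose σ hσ using fun i => hperm (ω i) ⟨FreeGroup.of i, by simp⟩
    have hw : ∀ w i, (W i).map (FreeGroup.lift ω w).val = W (FreeGroup.lift σ w i) := by
      intro w
      induction w using FreeGroup.induction_on with
      | C1 => intro i; rw [map_one, map_one]; exact Submodule.map_id (W i)
      | of x => intro i; simpa using hσ x i
      | inv_of x h =>
        intro i
        have h1 := h ((FreeGroup.lift σ (FreeGroup.of x))⁻¹ i)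
        rw [← Equiv.Perm.mul_apply, mul_inv_cancel, Equiv.Perm.one_apply] at h1
        rw [map_inv, map_inv, ← h1, ← Submodule.map_comp, ← Module.End.mul_eq_comp, ← Units.val_mul,
          inv_mul_cancel]
        exact Submodule.map_id _
      | mul x y hx hy =>
        intro i
        rw [map_mul, map_mul, Equiv.Perm.mul_apply, ← hx, ← hy, ← Submodule.map_comp]
        rfl
    have : Nonempty (Fin m) := ⟨⟨0, by omega⟩⟩
    -- A block of least dimension has dimension at most dim V / m, so transitivity on the blocks is
    -- not needed.
    obtain ⟨j, hj⟩ := Finite.exists_min fun i => Module.finrank k (W i)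
    have hsum : ∑ i, Module.finrank k (W i) = Module.finrank k V := by
      rw [← Module.finrank_directSum]
      exact (LinearEquiv.ofBijective (DirectSum.coeLinearMap W) hint).finrank_eq
    have hmj : m * Module.finrank k (W j) ≤ Module.finrank k V := by
      rw [← hsum]
      simpa using Finset.sum_le_sum fun i (_ : i ∈ Finset.univ) => hj i
    obtain ⟨v, hv, hv0⟩ := (W j).exists_mem_ne_zero_of_ne_bot (hne j)
    have hpos : 1 ≤ Module.finrank k (W j) := Submodule.one_le_finrank_iff.2 (hne j)
    refine ⟨m, hm, (Nat.le_mul_of_pos_right m hpos).trans hmj, σ, j, v, hv0,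
      le_trans (Submodule.finrank_mono ?_)
        ((Nat.le_div_iff_mul_le (by omega)).2 (by rwa [mul_comm]))⟩
    rw [Submodule.span_le]
    rintro _ ⟨⟨w, hwj⟩, rfl⟩
    have := Submodule.mem_map_of_mem (f := (FreeGroup.lift ω w).val) hv
    rwa [hw, hwj] at this
  · rintro ⟨m, hm, -, σ, j, v, hv0, hle⟩
    let W (i : Fin m) : Submodule k V := Submodule.span k
      ((fun w => (FreeGroup.lift ω w).val v) '' {w | FreeGroup.lift σ w j = i})
    have hmap : ∀ g i, (W i).map (FreeGroup.lift ω g).val ≤ W (FreeGroup.lift σ g i) := by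
      intro g i
      rw [Submodule.map_span_le]
      rintro _ ⟨w, hw, rfl⟩
      refine Submodule.subset_span ⟨g * w, ?_, ?_⟩
      · rw [Set.mem_ofPred_eq] at hw ⊢
        rw [map_mul, Equiv.Perm.mul_apply, hw]
      · simp
    have hmap' : ∀ g i, (W i).map (FreeGroup.lift ω g).val = W (FreeGroup.lift σ g i) := by
      intro g i
      refine (hmap g i).antisymm fun x hx => ?_
      have := hmap g⁻¹ _ (Submodule.mem_map_of_mem hx)
      rw [← Equiv.Perm.mul_apply, ← map_mul, inv_mul_cancel, map_one, Equiv.Perm.one_apply] at this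
      refine ⟨_, this, ?_⟩
      rw [← Module.End.mul_apply, ← Units.val_mul, ← map_mul, mul_inv_cancel, map_one]
      simp
    have htop : ⨆ i, W i = ⊤ := by
      rw [eq_top_iff, ← hirr v hv0, Submodule.span_le]
      rintro _ ⟨w, rfl⟩
      exact Submodule.mem_iSup_of_mem (FreeGroup.lift σ w j) (Submodule.subset_span ⟨w, rfl, rfl⟩)
    have hWj : Module.finrank k (W j) ≤ Module.finrank k V / m := by
      rwa [show W j = _ from congrArg (Submodule.span k) (Set.image_eq_range _ _)]
    have hd : ∀ i, Module.finrank k (W i) ≤ Module.finrank k V / m := by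
      intro i
      by_cases hi : ∃ w, FreeGroup.lift σ w j = i
      · obtain ⟨w, rfl⟩ := hi
        rw [← hmap']
        exact (Submodule.finrank_map_le _ _).trans hWj
      · have : W i = ⊥ := by
          rw [Submodule.span_eq_bot]
          rintro _ ⟨w, hw, rfl⟩
          exact absurd ⟨w, hw⟩ hi
        rw [this, finrank_bot]
        exact Nat.zero_le _
    -- The `W i` span V and have dimension at most dim V / m, so counting forces a direct sum with
    -- equal dimensions. As `W j` contains v, no summand is zero.
    obtain ⟨hint, heq⟩ := isInternal_of_iSup_eq_top_of_finrank_le W htop hd (Nat.mul_div_le _ _)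
    have hWj0 : W j ≠ ⊥ := by
      intro h
      rw [Submodule.span_eq_bot] at h
      exact hv0 (by simpa using h v ⟨1, by simp, by simp⟩)
    refine ⟨m, W, hm, fun i hi => hWj0 ?_, hint, ?_⟩
    · rw [← Submodule.finrank_eq_zero, heq, ← heq i, hi, finrank_bot]
    · rintro _ ⟨g, rfl⟩
      exact ⟨FreeGroup.lift σ g, hmap' g⟩

end

/-! ### Passage to the Zariski closure, and assembly -/

section

variable {k : Type*} [Field k] {V : Type*} [AddCommGroup V] [Module k V]

theorem le_zariskiClosure (H : Subgroup (LinearMap.GeneralLinearGroup k V)) :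
    H ≤ zariskiClosure H :=
  @subset_closure _ (zariskiGL k V) _

theorem zariskiClosure_subset {H : Subgroup (LinearMap.GeneralLinearGroup k V)}
    {Z : Set (LinearMap.GeneralLinearGroup k V)} (hZ : IsClosed[zariskiGL k V] Z)
    (h : (H : Set (LinearMap.GeneralLinearGroup k V)) ⊆ Z) :
    (zariskiClosure H : Set (LinearMap.GeneralLinearGroup k V)) ⊆ Z :=
  @closure_minimal _ (zariskiGL k V) _ _ h hZ

theorem isClosed_forall_mem (U U' : Submodule k V) :
    IsClosed[zariskiGL k V] {g | ∀ u ∈ U, g.val u ∈ U'} := by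
  refine (isClosed_zariskiTopology_iff _ _).2
    ⟨{f | ∃ φ ∈ U'.dualAnnihilator, ∃ u ∈ U, f = fun g => φ (g.val u)}, ?_, ?_⟩
  · rintro _ ⟨φ, -, u, -, rfl⟩
    exact coeff_mem_coordRingGL φ u
  · ext g
    constructor
    · rintro h _ ⟨φ, hφ, u, hu, rfl⟩
      exact (Submodule.mem_dualAnnihilator φ).1 hφ _ (h u hu)
    · intro h u hu
      rw [← Subspace.forall_mem_dualAnnihilator_apply_eq_zero_iff]
      exact fun φ hφ => h _ ⟨φ, hφ, u, hu, rfl⟩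

theorem isClosed_map_eq (U U' : Submodule k V) :
    IsClosed[zariskiGL k V] {g | U.map g.val = U'} := by
  let _ := zariskiGL k V
  have h := (isClosed_forall_mem U U').inter
    ((isClosed_forall_mem U' U).preimage continuous_inv_zariskiGL)
  convert! h using 1
  ext g
  constructor
  · rintro rfl
    refine ⟨fun u hu => Submodule.mem_map_of_mem hu, ?_⟩
    rintro _ ⟨u, hu, rfl⟩
    rwa [← Module.End.mul_apply, ← Units.val_mul, inv_mul_cancel, Units.val_one,
      Module.End.one_apply]
  · rintro ⟨h1, h2⟩
    refine le_antisymm (Submodule.map_le_iff_le_comap.2 h1) fun u hu => ⟨_, h2 u hu, ?_⟩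
    rw [← Module.End.mul_apply, ← Units.val_mul, mul_inv_cancel, Units.val_one,
      Module.End.one_apply]

theorem preservesDecomposition_zariskiClosure_iff
    (H : Subgroup (LinearMap.GeneralLinearGroup k V)) :
    PreservesDecomposition (zariskiClosure H) ↔ PreservesDecomposition H := by
  constructor
  · rintro ⟨m, W, hm, hne, hint, h⟩
    exact ⟨m, W, hm, hne, hint, fun g hg => h g (le_zariskiClosure H hg)⟩
  · rintro ⟨m, W, hm, hne, hint, h⟩
    let _ := zariskiGL k V
    refine ⟨m, W, hm, hne, hint, zariskiClosure_subset (Z := {g | ∃ σ : Equiv.Perm (Fin m),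
      ∀ i, (W i).map g.val = W (σ i)}) ?_ h⟩
    -- For a fixed decomposition there are finitely many σ, so this locus is a finite union of
    -- closed sets.
    simp only [Set.ofPred_exists, Set.ofPred_forall]
    exact isClosed_iUnion_of_finite fun σ => isClosed_iInter fun i => isClosed_map_eq _ _

theorem actsPrimitively_zariskiClosure_iff [Nontrivial V]
    (H : Subgroup (LinearMap.GeneralLinearGroup k V)) :
    ActsPrimitively (zariskiClosure H) ↔ ActsPrimitively H := by
  refine and_congr ?_ (preservesDecomposition_zariskiClosure_iff H).not
  rw [isIrreducible_naturalRep_iff, isIrreducible_naturalRep_iff]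
  refine forall_congr' fun U => imp_congr_left ⟨fun h g hg => h g (le_zariskiClosure H hg), ?_⟩
  exact fun h => zariskiClosure_subset (isClosed_forall_mem U U) h

theorem word_coeff_mem_coordRingGLPow [FiniteDimensional k V] (e : ℕ) (w : FreeGroup (Fin e)) :
    ∀ (φ : Module.Dual k V) (v : V),
      (fun x : Fin e → LinearMap.GeneralLinearGroup k V => φ ((FreeGroup.lift x w).val v)) ∈
        coordRingGLPow k V e := by
  induction w using FreeGroup.induction_on with
  | C1 =>
    intro φ v
    simp only [map_one, Units.val_one, Module.End.one_apply]
    exact (coordRingGLPow k V e).algebraMap_mem (φ v)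
  | of i =>
    intro φ v
    simp only [FreeGroup.lift_apply_of]
    exact Algebra.subset_adjoin ⟨i, _, coeff_mem_coordRingGL φ v, rfl⟩
  | inv_of i _ =>
    intro φ v
    simp only [map_inv, FreeGroup.lift_apply_of]
    exact Algebra.subset_adjoin ⟨i, _, coeff_inv_mem_coordRingGL φ v, rfl⟩
  | mul w₁ w₂ h₁ h₂ =>
    intro φ v
    let b := Module.finBasis k V
    have : (fun x : Fin e → LinearMap.GeneralLinearGroup k V =>
        φ ((FreeGroup.lift x (w₁ * w₂)).val v)) =
        ∑ t, (fun x => b.coord t ((FreeGroup.lift x w₂).val v)) *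
          (fun x => φ ((FreeGroup.lift x w₁).val (b t))) := by
      ext x
      conv_lhs => rw [map_mul, Units.val_mul, Module.End.mul_apply,
        ← b.sum_repr ((FreeGroup.lift x w₂).val v), map_sum, map_sum]
      simp only [map_smul, smul_eq_mul, Finset.sum_apply, Pi.mul_apply, Module.Basis.coord_apply]
    rw [this]
    exact Subalgebra.sum_mem _ fun t _ => Subalgebra.mul_mem _ (h₂ _ _) (h₁ _ _)

/-- Spanning V is written as dimension > dim V - 1, valid since dim V > 0, so that both kinds of
condition fit the same openness lemma. -/
theorem actsPrimitively_closure_iff [FiniteDimensional k V] [Nontrivial V] {ι : Type*}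
    (ω : ι → LinearMap.GeneralLinearGroup k V) :
    ActsPrimitively (Subgroup.closure (Set.range ω)) ↔
      (∀ v : V, v ≠ 0 → Module.finrank k V - 1 < Module.finrank k (Submodule.span k
        (Set.range fun w => (FreeGroup.lift ω w).val v))) ∧
      ∀ m ∈ Finset.Icc 2 (Module.finrank k V), ∀ (σ : ι → Equiv.Perm (Fin m)) (j : Fin m) (v : V),
        v ≠ 0 → Module.finrank k V / m < Module.finrank k (Submodule.span k (Set.range
          fun w : {w : FreeGroup ι // FreeGroup.lift σ w j = j} =>
            (FreeGroup.lift ω w.1).val v)) := by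
  have hpos : 0 < Module.finrank k V := Module.finrank_pos
  have htop : ∀ U : Submodule k V, Module.finrank k V - 1 < Module.finrank k U ↔ U = ⊤ := by
    intro U
    constructor
    · intro h
      exact Submodule.eq_top_of_finrank_eq (le_antisymm U.finrank_le (by omega))
    · rintro rfl
      rw [finrank_top]
      omega
  rw [ActsPrimitively, ← FreeGroup.range_lift_eq_closure, isIrreducible_naturalRep_range_iff]
  simp only [htop]
  refine and_congr_right fun hirr => ?_
  rw [preservesDecomposition_range_lift_iff ω hirr]
  push Not
  simp only [Finset.mem_Icc, and_imp]

theorem isOpen_actsPrimitively_closure [IsAlgClosed k] [FiniteDimensional k V] [Nontrivial V]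
    (e : ℕ) :
    IsOpen[zariskiGLPow k V e] {ω | ActsPrimitively (Subgroup.closure (Set.range ω))} := by
  let _ := zariskiGLPow k V e
  let A := coordRingGLPow k V e
  have hirr := isOpen_forall_lt_finrank_span A
    (fun (w : FreeGroup (Fin e)) x => (FreeGroup.lift x w).val)
    (fun w => word_coeff_mem_coordRingGLPow e w) (Module.finrank k V - 1)
  have hstab (m : ℕ) (σ : Fin e → Equiv.Perm (Fin m)) (j : Fin m) :=
    isOpen_forall_lt_finrank_span A
      (fun (w : {w : FreeGroup (Fin e) // FreeGroup.lift σ w j = j}) x => (FreeGroup.lift x w.1).val)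
      (fun w => word_coeff_mem_coordRingGLPow e w.1) (Module.finrank k V / m)
  convert! hirr.inter (isOpen_biInter_finset
    fun m (_ : m ∈ Finset.Icc 2 (Module.finrank k V)) =>
      isOpen_iInter_of_finite fun σ => isOpen_iInter_of_finite fun j => hstab m σ j) using 1
  ext ω
  simp only [Set.mem_inter_iff, Set.mem_iInter, Set.mem_ofPred_eq]
  exact actsPrimitively_closure_iff ω

end

end PrimitiveTuples

theorem theorem2p9 {k : Type*} [Field k] [IsAlgClosed k] {V : Type*} [AddCommGroup V] [Module k V]
    [FiniteDimensional k V] [Nontrivial V] (e : ℕ) :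
    IsOpen[PrimitiveTuples.zariskiGLPow k V e]
      {ω : Fin e → LinearMap.GeneralLinearGroup k V |
        PrimitiveTuples.ActsPrimitively (Subgroup.closure (Set.range ω))} ∧
    IsOpen[PrimitiveTuples.zariskiGLPow k V e]
      {ω : Fin e → LinearMap.GeneralLinearGroup k V |
        PrimitiveTuples.ActsPrimitively
          (PrimitiveTuples.zariskiClosure (Subgroup.closure (Set.range ω)))} := by
  simp only [PrimitiveTuples.actsPrimitively_zariskiClosure_iff, and_self]
  exact PrimitiveTuples.isOpen_actsPrimitively_closure e
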